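/- Conventions. A continuum in a metric space $X$ is a nonempty compact connected subset of $X$ (one-point sets are allowed), and an arc in $X$ is a subset homeomorphic to $[0,1]$. A triod is a continuum $K$ for which there is a continuum $L\subseteq K$ such that $K\setminus L$ has at least three connected components. For a metric space $X$ let $$E^A_X=\{(x,y)\in X\times X:\ x=y\text{ or some arc in }X\text{ contains both }x\text{ and }y\}.$$ For $\varepsilon>0$ let $E^{CC,\varepsilon}_X$ be the equivalence relation on $X$ consisting of all $(x,y)\in X\times X$ for which there are $k\in\mathbb N$ and continua $K_0,\dots,K_k\subseteq X$ of diameter less than $\varepsilon$ such that $x\in K_0$, $y\in K_k$ and $K_i\cap K_{i+1}\neq\emptyset$ for $0\le i<k$. Let $E^{CC}_X=\bigcap_{\varepsilon>0}E^{CC,\varepsilon}_X$. (1) Let $X$ be a metric space. Suppose that for every integer $n\ge 1$, no equivalence class of $E^{CC,1/n}_X$ contains a triod (as a subset). Then $E^{CC}_X=E^A_X$. (2) Let $X$ be a Polish space (with any compatible metric) that contains no triod. Then $E^{CC}_X=E^A_X$. -/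

import Mathlib

namespace ContinuumConnection

/-- A continuum in `X`: a nonempty compact connected subset (one-point sets are continua;
`IsConnected` includes nonemptiness). -/
def IsContinuum {X : Type*} [TopologicalSpace X] (K : Set X) : Prop :=
  IsCompact K ∧ IsConnected K

/-- An arc in `X`: a subset homeomorphic to `[0, 1]`. -/
def IsArc {X : Type*} [TopologicalSpace X] (A : Set X) : Prop :=
  Nonempty (unitInterval ≃ₜ A)

/-- A triod: a continuum `K` with a subcontinuum `L` such that `K \ L` has at least three
connected components. -/
def IsTriod {X : Type*} [TopologicalSpace X] (K : Set X) : Prop :=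
  IsContinuum K ∧ ∃ L : Set X, IsContinuum L ∧ L ⊆ K ∧
    3 ≤ ENat.card (ConnectedComponents ↥(K \ L))

/-- The arc-connection relation `E^A_X`. Every point is related to itself, also when it lies
on no nondegenerate arc. -/
def arcRel (X : Type*) [TopologicalSpace X] : Set (X × X) :=
  {p | p.1 = p.2 ∨ ∃ A : Set X, IsArc A ∧ p.1 ∈ A ∧ p.2 ∈ A}

/-- The relation `E^{CC,ε}_X`: being joined by a finite chain `K 0, …, K k` of continua of
diameter less than `ε`. -/
def chainRelAt (X : Type*) [MetricSpace X] (ε : ℝ) : Set (X × X) :=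
  {p | ∃ (k : ℕ) (K : ℕ → Set X),
    (∀ i ≤ k, IsContinuum (K i) ∧ Metric.diam (K i) < ε) ∧
    p.1 ∈ K 0 ∧ p.2 ∈ K k ∧ ∀ i < k, (K i ∩ K (i + 1)).Nonempty}

/-- The chain continuum-connection relation `E^{CC}_X`. -/
def chainRel (X : Type*) [MetricSpace X] : Set (X × X) :=
  {p | ∀ ε : ℝ, 0 < ε → p ∈ chainRelAt X ε}

/-- The class of `x` with respect to a relation `E`. -/
def relClass {X : Type*} (E : Set (X × X)) (x : X) : Set X :=
  {y | (x, y) ∈ E}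

end ContinuumConnection

open ContinuumConnection

/-!
In the absence of triods, of three continua with a common point one lies in the union of the other
two, and two continua meet in at most two components. From these two facts, at most two continua
are irreducible between two given points `x` and `y`. If `x` and `y` are joined by chains of
arbitrarily small continua, then by pigeonhole a single irreducible continuum `D` lies in the unions
of arbitrarily fine chains; intersecting it with their links shows that `D` is a finite union of
arbitrarily small continua. Shortest paths in the nerves of such decompositions are chains in which
only neighbours meet, and irreducibility forces the part of `D` between `x` and `z` to agree, up to
two links, with the part of the chain that precedes `z`. These initial parts therefore depend
continuously and strictly monotonically on `z`, and a Whitney map on the hyperspace of `X` embeds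
`D` in the real line: `D` is an arc.
-/

namespace ContinuumConnection

open Set Metric Topology Function TopologicalSpace

section Components

variable {α : Type*} [TopologicalSpace α]

theorem exists_continuous_preimage_singleton_eq {ι : Type*} [Finite ι] [TopologicalSpace ι]
    {F : ι → Set α} (hF : ∀ i, IsClosed (F i)) (hdisj : Pairwise (Disjoint on F))
    (hcover : ⋃ i, F i = univ) : ∃ g : α → ι, Continuous g ∧ ∀ i, g ⁻¹' {i} = F i := by
  choose g hg using fun x => mem_iUnion.1 (hcover ▸ mem_univ x : x ∈ ⋃ i, F i)
  have hfiber : ∀ i, g ⁻¹' {i} = F i := fun i => Subset.antisymm (fun x hx => hx ▸ hg x)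
    fun x hx => hdisj.eq (not_disjoint_iff.2 ⟨x, hg x, hx⟩)
  refine ⟨g, continuous_iff_isClosed.2 fun s _ => ?_, hfiber⟩
  rw [← biUnion_preimage_singleton]
  exact s.toFinite.isClosed_biUnion fun i _ => hfiber i ▸ hF i

theorem le_card_connectedComponents_iff {n : ℕ} [NeZero n] :
    (n : ℕ∞) ≤ ENat.card (ConnectedComponents α) ↔
      ∃ g : α → Fin n, Continuous g ∧ Surjective g := by
  refine ⟨fun hn => ?_, fun ⟨g, hg, hsurj⟩ => ?_⟩
  · cases finite_or_infinite (ConnectedComponents α)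
    · obtain ⟨f⟩ : Nonempty (Fin n ↪ ConnectedComponents α) := by
        cases nonempty_fintype (ConnectedComponents α)
        rw [ENat.card_eq_coe_fintype_card, Nat.cast_le] at hn
        exact Embedding.nonempty_of_card_le (by simpa using hn)
      exact ⟨invFun f ∘ ConnectedComponents.mk,
        continuous_of_discreteTopology.comp ConnectedComponents.continuous_coe,
        (invFun_surjective f.injective).comp ConnectedComponents.surjective_coe⟩
    · obtain ⟨U, hU, hne, hdisj, hcover⟩ :=
        ConnectedComponents.exists_fun_isClopen_of_infinite α n (NeZero.pos n)
      obtain ⟨g, hg, hfiber⟩ :=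
        exists_continuous_preimage_singleton_eq (fun i => (hU i).isClosed) hdisj hcover
      refine ⟨g, hg, fun i => ?_⟩
      obtain ⟨x, hx⟩ := hne i
      exact ⟨x, (hfiber i).ge hx⟩
  · have hlift : Surjective hg.connectedComponentsLift := fun i =>
      (hsurj i).imp' ConnectedComponents.mk fun x hx => hx
    simpa using ENat.card_le_card_of_injective (injective_surjInv hlift)

theorem exists_isClopen_subset_of_connectedComponent_subset [CompactSpace α] [T2Space α]
    {O : Set α} {p : α} (hO : IsOpen O) (hp : connectedComponent p ⊆ O) :
    ∃ W, IsClopen W ∧ p ∈ W ∧ W ⊆ O := by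
  have himage : IsClosed (ConnectedComponents.mk '' Oᶜ) :=
    (hO.isClosed_compl.isCompact.image ConnectedComponents.continuous_coe).isClosed
  have hpO : ConnectedComponents.mk p ∈ (ConnectedComponents.mk '' Oᶜ)ᶜ := by
    rintro ⟨q, hq, hqp⟩
    exact hq (hp (ConnectedComponents.coe_eq_coe'.1 hqp))
  obtain ⟨V, hV, hpV, hVO⟩ := compact_exists_isClopen_in_isOpen himage.isOpen_compl hpO
  exact ⟨_, hV.preimage ConnectedComponents.continuous_coe, hpV,
    fun q hq => by_contra fun hqO => hVO hq ⟨q, hqO, rfl⟩⟩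

theorem finite_image_connectedComponentIn {S : Set α} [Finite (ConnectedComponents S)] :
    (connectedComponentIn S '' S).Finite := by
  refine (finite_range fun c : ConnectedComponents S =>
    (↑) '' (ConnectedComponents.mk ⁻¹' {c} : Set S)).subset ?_
  rintro _ ⟨p, hp, rfl⟩
  exact ⟨.mk ⟨p, hp⟩, (congrArg (Subtype.val '' ·) connectedComponents_preimage_singleton).trans
    (connectedComponentIn_eq_image hp).symm⟩

end Components

section Continua

variable {X ι : Type*} [TopologicalSpace X] {K L O S : Set X} {p : X}

theorem IsContinuum.isClosed [T2Space X] (hK : IsContinuum K) : IsClosed K :=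
  hK.1.isClosed

theorem IsContinuum.union (hK : IsContinuum K) (hL : IsContinuum L) (hKL : (K ∩ L).Nonempty) :
    IsContinuum (K ∪ L) :=
  ⟨hK.1.union hL.1, hK.2.union hKL hL.2⟩

theorem IsContinuum.union_iUnion [Finite ι] {Z : ι → Set X} (hL : IsContinuum L)
    (hZ : ∀ i, IsContinuum (Z i)) (hmeet : ∀ i, (L ∩ Z i).Nonempty) :
    IsContinuum (L ∪ ⋃ i, Z i) := by
  obtain ⟨p, hp⟩ := hL.2.1
  refine ⟨hL.1.union (isCompact_iUnion fun i => (hZ i).1), ⟨p, .inl hp⟩,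
    isPreconnected_of_forall p ?_⟩
  rintro q (hq | hq)
  · exact ⟨L, subset_union_left, hp, hq, hL.2.2⟩
  · obtain ⟨i, hi⟩ := mem_iUnion.1 hq
    exact ⟨L ∪ Z i, union_subset_union_right L (subset_iUnion Z i), .inl hp, .inr hi,
      (hL.union (hZ i) (hmeet i)).2.2⟩

theorem isContinuum_iUnion [Finite ι] [Nonempty ι] {Z : ι → Set X}
    (hZ : ∀ i, IsContinuum (Z i)) (hp : ∀ i, p ∈ Z i) : IsContinuum (⋃ i, Z i) :=
  ⟨isCompact_iUnion fun i => (hZ i).1, ⟨p, mem_iUnion_of_mem (Classical.arbitrary ι) (hp _)⟩,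
    isPreconnected_iUnion ⟨p, mem_iInter.2 hp⟩ fun i => (hZ i).2.2⟩

theorem isContinuum_connectedComponentIn (hS : IsCompact S) (hp : p ∈ S) :
    IsContinuum (connectedComponentIn S p) := by
  refine ⟨?_, isConnected_connectedComponentIn_iff.2 hp⟩
  have : CompactSpace S := isCompact_iff_compactSpace.1 hS
  rw [connectedComponentIn_eq_image hp]
  exact isClosed_connectedComponent.isCompact.image continuous_subtype_val

theorem isContinuum_sInter [T2Space X] {c : Set (Set X)} (hc : ∀ K ∈ c, IsContinuum K)
    (hdir : DirectedOn (· ⊇ ·) c) (hne : c.Nonempty) : IsContinuum (⋂₀ c) := by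
  have : Nonempty c := hne.to_subtype
  have hclosed : IsClosed (⋂₀ c) := isClosed_sInter fun K hK => (hc K hK).isClosed
  have hcompact : IsCompact (⋂₀ c) :=
    hne.elim fun K hK => (hc K hK).1.of_isClosed_subset hclosed (sInter_subset_of_mem hK)
  refine ⟨hcompact,
    IsCompact.nonempty_sInter_of_directed_nonempty_isCompact_isClosed hdir
      (fun K hK => (hc K hK).2.1) (fun K hK => (hc K hK).1) fun K hK => (hc K hK).isClosed,
    (isPreconnected_iff_subset_of_fully_disjoint_closed hclosed).2 fun a b ha hb hab hdisj => ?_⟩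
  obtain ⟨u, v, hu, hv, hau, hbv, huv⟩ :=
    SeparatedNhds.of_isCompact_isCompact (hcompact.inter_right ha) (hcompact.inter_right hb)
      (hdisj.mono inter_subset_right inter_subset_right)
  obtain ⟨⟨K, hK⟩, hKuv⟩ := exists_subset_nhds_of_isCompact (V := fun K : c => (K : Set X))
    hdir.directed_val (fun K => (hc K K.2).1) fun z hz => (hu.union hv).mem_nhds <| by
      rw [← sInter_eq_iInter] at hz
      exact (hab hz).imp (fun h => hau ⟨hz, h⟩) fun h => hbv ⟨hz, h⟩
  have hsub : ⋂₀ c ⊆ K := sInter_subset_of_mem hK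
  refine ((hc K hK).2.2.subset_or_subset hu hv huv hKuv).imp (fun h z hz => ?_) fun h z hz => ?_
  · exact (hab hz).resolve_right fun hzb => huv.le_bot ⟨h (hsub hz), hbv ⟨hz, hzb⟩⟩
  · exact (hab hz).resolve_left fun hza => huv.le_bot ⟨hau ⟨hz, hza⟩, h (hsub hz)⟩

theorem IsContinuum.not_connectedComponentIn_inter_closure_subset [T2Space X] (hK : IsContinuum K)
    (hO : IsOpen O) (hpK : p ∈ K) (hpO : p ∈ O) (hKO : ¬ K ⊆ O) :
    ¬ connectedComponentIn (K ∩ closure O) p ⊆ O := by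
  have hpS : p ∈ K ∩ closure O := ⟨hpK, subset_closure hpO⟩
  have : CompactSpace ↥(K ∩ closure O) :=
    isCompact_iff_compactSpace.1 (hK.1.inter_right isClosed_closure)
  rw [connectedComponentIn_eq_image hpS, image_subset_iff]
  intro hsub
  obtain ⟨W, hW, hpW, hWO⟩ := exists_isClopen_subset_of_connectedComponent_subset
    (hO.preimage continuous_subtype_val) hsub
  have himage : ∀ V : Set ↥(K ∩ closure O), IsClosed V → IsClosed ((↑) '' V : Set X) :=
    fun V hV => (hV.isCompact.image continuous_subtype_val).isClosed
  obtain ⟨k, hk, hkO⟩ := not_subset.1 hKO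
  obtain ⟨_, -, ⟨z, hz, rfl⟩, hz'⟩ := isPreconnected_closed_iff.1 hK.2.2 _ _
    (himage W hW.isClosed) ((himage Wᶜ hW.compl.isClosed).union hO.isClosed_compl)
    (fun z hz => by
      by_cases hzO : z ∈ O
      · by_cases hzW : (⟨z, hz, subset_closure hzO⟩ : ↥(K ∩ closure O)) ∈ W
        exacts [.inl ⟨_, hzW, rfl⟩, .inr (.inl ⟨_, hzW, rfl⟩)]
      · exact .inr (.inr hzO))
    ⟨p, hpK, _, hpW, rfl⟩ ⟨k, hk, .inr hkO⟩
  rcases hz' with ⟨z', hz', heq⟩ | hzO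
  · exact hz' (Subtype.coe_injective heq ▸ hz)
  · exact hzO (hWO hz)

end Continua

/-- A set is atriodic if none of its subsets is a triod. -/
def Atriodic {X : Type*} [TopologicalSpace X] (G : Set X) : Prop :=
  ¬ ∃ T : Set X, IsTriod T ∧ T ⊆ G

section Triods

variable {X : Type*} [TopologicalSpace X] {G K L O S : Set X} {a b p : X}

theorem Atriodic.mono {H : Set X} (hG : Atriodic G) (hHG : H ⊆ G) : Atriodic H :=
  fun ⟨T, hT, hTH⟩ => hG ⟨T, hT, hTH.trans hHG⟩

theorem isTriod_union_iUnion [T2Space X] {Z : Fin 3 → Set X} (hL : IsContinuum L)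
    (hZ : ∀ i, IsContinuum (Z i)) (hmeet : ∀ i, (L ∩ Z i).Nonempty) (hleave : ∀ i, ¬ Z i ⊆ L)
    (hinter : Pairwise fun i j => Z i ∩ Z j ⊆ L) : IsTriod (L ∪ ⋃ i, Z i) := by
  refine ⟨hL.union_iUnion hZ hmeet, L, hL, subset_union_left, ?_⟩
  obtain ⟨g, hg, hfiber⟩ := exists_continuous_preimage_singleton_eq
    (F := fun i => ((↑) : ↥((L ∪ ⋃ i, Z i) \ L) → X) ⁻¹' Z i)
    (fun i => (hZ i).isClosed.preimage continuous_subtype_val)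
    (fun i j hij => Set.disjoint_left.2 fun z hi hj => z.2.2 (hinter hij ⟨hi, hj⟩))
    (by
      rw [← preimage_iUnion, eq_univ_iff_forall]
      exact fun z => z.2.1.resolve_left z.2.2)
  refine le_card_connectedComponents_iff.2 ⟨g, hg, fun i => ?_⟩
  obtain ⟨z, hz, hzL⟩ := not_subset.1 (hleave i)
  exact ⟨⟨z, .inr (mem_iUnion_of_mem i hz), hzL⟩, (hfiber i).ge hz⟩

theorem IsContinuum.exists_leg [T2Space X] (hK : IsContinuum K) (hO : IsOpen O) (hpK : p ∈ K)
    (hpO : p ∈ O) (hKO : ¬ K ⊆ O) (hKL : K ∩ L ∩ closure O ⊆ O) :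
    ∃ Z, IsContinuum Z ∧ p ∈ Z ∧ Z ⊆ K ∩ closure O ∧ ¬ Z ⊆ L := by
  have hpS : p ∈ K ∩ closure O := ⟨hpK, subset_closure hpO⟩
  have hsub := connectedComponentIn_subset (K ∩ closure O) p
  exact ⟨_, isContinuum_connectedComponentIn (hK.1.inter_right isClosed_closure) hpS,
    mem_connectedComponentIn hpS, hsub, fun hZL =>
      hK.not_connectedComponentIn_inter_closure_subset hO hpK hpO hKO fun z hz =>
        hKL ⟨⟨(hsub hz).1, hZL hz⟩, (hsub hz).2⟩⟩

/-- Three clopen pieces of `K ∩ L` would be the level sets of a function on the whole space; `K`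
then contains three disjoint legs growing out of `L`, each near one level. -/
theorem Atriodic.card_connectedComponents_inter_le_two [T4Space X] (h : Atriodic (K ∪ L))
    (hK : IsContinuum K) (hL : IsContinuum L) :
    ENat.card (ConnectedComponents ↥(K ∩ L)) ≤ 2 := by
  by_contra! hcard
  obtain ⟨g, hg, hsurj⟩ := (le_card_connectedComponents_iff (n := 3)).1
    (Order.add_one_le_of_lt hcard)
  obtain ⟨φ, hφ⟩ := ContinuousMap.exists_restrict_eq (hK.isClosed.inter hL.isClosed)
    ⟨fun z => ((g z : ℕ) : ℝ),
      (continuous_of_discreteTopology (f := fun i : Fin 3 => ((i : ℕ) : ℝ))).comp hg⟩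
  have hφg : ∀ z : ↥(K ∩ L), φ z = (g z : ℕ) := fun z => DFunLike.congr_fun hφ z
  have hdist : ∀ i j : Fin 3, i ≠ j → 1 ≤ dist ((i : ℕ) : ℝ) (j : ℕ) := fun i j hij => by
    simpa using Nat.pairwise_one_le_dist (Fin.val_ne_of_ne hij)
  let O : Fin 3 → Set X := fun i => φ ⁻¹' ball (i : ℕ) (1 / 3)
  have hclosure : ∀ i, closure (O i) ⊆ φ ⁻¹' closedBall (i : ℕ) (1 / 3) := fun i =>
    (isClosed_closedBall.preimage φ.continuous).closure_subset_iff.2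
      (preimage_mono ball_subset_closedBall)
  have heq : ∀ (i : Fin 3) (z : ↥(K ∩ L)), φ z ∈ closedBall ((i : ℕ) : ℝ) (1 / 3) → g z = i :=
    fun i z hz => by_contra fun hne => by
      rw [hφg, mem_closedBall] at hz
      linarith [hdist _ _ hne]
  have hself : ∀ z : ↥(K ∩ L), (z : X) ∈ O (g z) := fun z => by simp [O, hφg]
  choose q hq using hsurj
  have hleg : ∀ i, ∃ Z, IsContinuum Z ∧ (q i : X) ∈ Z ∧ Z ⊆ K ∩ closure (O i) ∧ ¬ Z ⊆ L := by
    refine fun i => hK.exists_leg (isOpen_ball.preimage φ.continuous) (q i).2.1 ?_ ?_ ?_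
    · simpa only [hq] using hself (q i)
    · obtain ⟨j, hj⟩ := exists_ne i
      refine fun hKO => hj ?_
      rw [← hq j]
      exact heq i _ (ball_subset_closedBall (hKO (q j).2.1))
    · intro z hz
      have hgz := heq i ⟨z, hz.1⟩ (hclosure i hz.2)
      exact hgz ▸ hself ⟨z, hz.1⟩
  choose Z hZ hqZ hZK hZL using hleg
  refine h ⟨_, isTriod_union_iUnion hL hZ (fun i => ⟨q i, (q i).2.2, hqZ i⟩) hZL ?_, ?_⟩
  · rintro i j hij z ⟨hi, hj⟩
    have hi' : dist (φ z) (i : ℕ) ≤ 1 / 3 := hclosure i (hZK i hi).2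
    have hj' : dist (φ z) (j : ℕ) ≤ 1 / 3 := hclosure j (hZK j hj).2
    linarith [hdist i j hij, dist_triangle_left ((i : ℕ) : ℝ) (j : ℕ) (φ z)]
  · exact union_subset subset_union_right
      (iUnion_subset fun i => ((hZK i).trans inter_subset_left).trans subset_union_left)

theorem Atriodic.finite_connectedComponents_inter [T4Space X] (h : Atriodic (K ∪ L))
    (hK : IsContinuum K) (hL : IsContinuum L) : Finite (ConnectedComponents ↥(K ∩ L)) :=
  ENat.card_lt_top.1
    ((h.card_connectedComponents_inter_le_two hK hL).trans_lt (ENat.natCast_lt_top 2))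

theorem eq_union_connectedComponentIn_of_card_le_two
    (hS : ENat.card (ConnectedComponents S) ≤ 2) (ha : a ∈ S) (hb : b ∈ S)
    (hab : b ∉ connectedComponentIn S a) :
    S = connectedComponentIn S a ∪ connectedComponentIn S b := by
  refine Subset.antisymm (fun c hc => ?_)
    (union_subset (connectedComponentIn_subset S a) (connectedComponentIn_subset S b))
  by_contra! hcab
  have hne : ∀ {u v : X} (hu : u ∈ S) (hv : v ∈ S), v ∉ connectedComponentIn S u →
      (ConnectedComponents.mk ⟨u, hu⟩ : ConnectedComponents S) ≠ ConnectedComponents.mk ⟨v, hv⟩ :=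
    fun hu hv huv heq => huv <| by
      rw [connectedComponentIn_eq_image hu]
      exact ⟨_, ConnectedComponents.coe_eq_coe'.1 heq.symm, rfl⟩
  have hthree := encard_eq_three.2 ⟨_, _, _, hne ha hb hab, hne ha hc fun h => hcab (.inl h),
    hne hb hc fun h => hcab (.inr h), rfl⟩
  exact absurd (hthree.ge.trans (encard_le_card.trans hS)) (by decide)

theorem isClosed_diff_connectedComponentIn [T2Space X] [Finite (ConnectedComponents S)]
    (hS : IsCompact S) (hp : p ∈ S) : IsClosed (S \ connectedComponentIn S p) := by
  have : CompactSpace S := isCompact_iff_compactSpace.1 hS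
  have hopen : IsOpen (connectedComponent (⟨p, hp⟩ : S)) := by
    rw [← connectedComponents_preimage_singleton]
    exact (isOpen_discrete _).preimage ConnectedComponents.continuous_coe
  rw [connectedComponentIn_eq_image hp]
  convert (hopen.isClosed_compl.isCompact.image continuous_subtype_val).isClosed using 1
  rw [image_compl_eq_range_sdiff_image Subtype.val_injective, Subtype.range_coe]

variable [T4Space X]

theorem Atriodic.exists_leg (h : Atriodic (K ∪ L)) (hK : IsContinuum K) (hL : IsContinuum L)
    (hp : p ∈ K ∩ L) (hKL : ¬ K ⊆ L) :
    ∃ Z, IsContinuum Z ∧ p ∈ Z ∧ Z ⊆ K ∧ ¬ Z ⊆ L ∧ Z ∩ L ⊆ connectedComponentIn (K ∩ L) p := by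
  have hS : IsCompact (K ∩ L) := hK.1.inter_right hL.isClosed
  have := h.finite_connectedComponents_inter hK hL
  have hPsub := connectedComponentIn_subset (K ∩ L) p
  have hP := (isContinuum_connectedComponentIn hS hp).isClosed
  have hR := isClosed_diff_connectedComponentIn hS hp
  have hpP := mem_connectedComponentIn hp
  set P := connectedComponentIn (K ∩ L) p
  obtain ⟨k, hkK, hkL⟩ := not_subset.1 hKL
  obtain ⟨U, V, hU, hV, hPU, hRV, hUV⟩ := normal_separation hP (hR.union isClosed_singleton)
    (disjoint_sdiff_right.union_right (disjoint_singleton_right.2 fun hk => hkL (hPsub hk).2))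
  rw [union_singleton, insert_subset_iff] at hRV
  have hclosure : K ∩ L ∩ closure U ⊆ P := fun z hz => by_contra fun hzP =>
    (hUV.closure_left hV).le_bot ⟨hz.2, hRV.2 ⟨hz.1, hzP⟩⟩
  obtain ⟨Z, hZ, hpZ, hZK, hZL⟩ := hK.exists_leg hU hp.1 (hPU hpP)
    (fun hKU => hUV.le_bot ⟨hKU hkK, hRV.1⟩) (hclosure.trans hPU)
  exact ⟨Z, hZ, hpZ, hZK.trans inter_subset_left, hZL, fun z hz =>
    hclosure ⟨⟨(hZK hz.1).1, hz.2⟩, (hZK hz.1).2⟩⟩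

theorem Atriodic.exists_subset_iUnion_ne {A : Fin 3 → Set X} (h : Atriodic (⋃ i, A i))
    (hA : ∀ i, IsContinuum (A i)) (hp : ∀ i, p ∈ A i) :
    ∃ i, A i ⊆ ⋃ j : {j // j ≠ i}, A j := by
  by_contra! hcon
  let B : Fin 3 → Set X := fun i => ⋃ j : {j // j ≠ i}, A j
  have hAB : ∀ i j, j ≠ i → A j ⊆ B i := fun i j hj =>
    subset_iUnion (fun j : {j // j ≠ i} => A j) ⟨j, hj⟩
  have hpB : ∀ i, p ∈ A i ∩ B i := fun i =>
    ⟨hp i, (exists_ne i).elim fun j hj => hAB i j hj (hp j)⟩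
  have hB : ∀ i, IsContinuum (B i) := fun i =>
    have : Nonempty {j // j ≠ i} := nonempty_subtype.2 (exists_ne i)
    isContinuum_iUnion (fun j => hA j) fun j => hp j
  have hG : ∀ i, A i ∪ B i ⊆ ⋃ i, A i := fun i =>
    union_subset (subset_iUnion A i) (iUnion_subset fun j => subset_iUnion A j)
  choose Z hZ hpZ hZA hZB hZP using fun i =>
    (h.mono (hG i)).exists_leg (hA i) (hB i) (hpB i) (hcon i)
  let P : Fin 3 → Set X := fun i => connectedComponentIn (A i ∩ B i) p
  have hP : ∀ i, P i ⊆ A i ∩ B i := fun i => connectedComponentIn_subset _ _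
  have hpP : ∀ i, p ∈ P i := fun i => mem_connectedComponentIn (hpB i)
  refine h ⟨_, isTriod_union_iUnion (L := ⋃ i, P i) (Z := Z) (isContinuum_iUnion (fun i =>
    isContinuum_connectedComponentIn ((hA i).1.inter_right (hB i).isClosed) (hpB i)) hpP) hZ
    (fun i => ⟨p, mem_iUnion_of_mem i (hpP i), hpZ i⟩) (fun i hZL => hZB i ?_) ?_, ?_⟩
  · refine hZL.trans (iUnion_subset fun j => ?_)
    rcases eq_or_ne j i with rfl | hj
    exacts [(hP j).trans inter_subset_right, ((hP j).trans inter_subset_left).trans (hAB i j hj)]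
  · exact fun i j hij z hz =>
      mem_iUnion_of_mem i (hZP i ⟨hz.1, hAB i j hij.symm (hZA j hz.2)⟩)
  · exact union_subset (iUnion_mono fun i => (hP i).trans inter_subset_left) (iUnion_mono hZA)

theorem Atriodic.subset_union_or_subset_union {A B C : Set X} (h : Atriodic (A ∪ B ∪ C))
    (hA : IsContinuum A) (hB : IsContinuum B) (hC : IsContinuum C) (hpA : p ∈ A) (hpB : p ∈ B)
    (hpC : p ∈ C) : A ⊆ B ∪ C ∨ B ⊆ A ∪ C ∨ C ⊆ A ∪ B := by
  have hunion : ⋃ i, ![A, B, C] i ⊆ A ∪ B ∪ C := iUnion_subset fun i => by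
    fin_cases i
    exacts [subset_union_left.trans subset_union_left,
      subset_union_right.trans subset_union_left, subset_union_right]
  obtain ⟨i, hi⟩ := (h.mono hunion).exists_subset_iUnion_ne (p := p)
    (by simp [Fin.forall_fin_succ, hA, hB, hC]) (by simp [Fin.forall_fin_succ, hpA, hpB, hpC])
  simp only [iUnion_subtype] at hi
  fin_cases i
  · refine .inl (hi.trans ?_)
    simp [Fin.forall_fin_succ]
  · refine .inr (.inl (hi.trans ?_))
    simp [Fin.forall_fin_succ]
  · refine .inr (.inr (hi.trans ?_))
    simp [Fin.forall_fin_succ]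

end Triods

/-- `D` is irreducible between `x` and `y`: it is minimal among the continua containing both. -/
def IsIrreducibleBetween {X : Type*} [TopologicalSpace X] (D : Set X) (x y : X) : Prop :=
  Minimal (fun N : Set X => IsContinuum N ∧ x ∈ N ∧ y ∈ N) D

/-- The continua inside `G` that are irreducible between `x` and `y`. -/
def irreducibleContinua {X : Type*} [TopologicalSpace X] (G : Set X) (x y : X) : Set (Set X) :=
  {D | IsIrreducibleBetween D x y ∧ D ⊆ G}

section Irreducible

variable {X : Type*} [TopologicalSpace X] {D E F G K P Q : Set X} {p x y : X}

namespace IsIrreducibleBetween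

theorem isContinuum (h : IsIrreducibleBetween D x y) : IsContinuum D := h.1.1

theorem left_mem (h : IsIrreducibleBetween D x y) : x ∈ D := h.1.2.1

theorem right_mem (h : IsIrreducibleBetween D x y) : y ∈ D := h.1.2.2

theorem symm (h : IsIrreducibleBetween D x y) : IsIrreducibleBetween D y x := by
  simpa only [IsIrreducibleBetween, and_comm] using h

theorem union_eq (h : IsIrreducibleBetween D x y) (hP : IsContinuum P) (hQ : IsContinuum Q)
    (hPD : P ⊆ D) (hQD : Q ⊆ D) (hx : x ∈ P) (hy : y ∈ Q) (hPQ : (P ∩ Q).Nonempty) :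
    P ∪ Q = D :=
  h.eq_of_subset ⟨hP.union hQ hPQ, .inl hx, .inr hy⟩ (union_subset hPD hQD)

variable [T2Space X]

theorem isContinuum_connectedComponentIn_inter (hD : IsIrreducibleBetween D x y)
    (hE : IsIrreducibleBetween E x y) : IsContinuum (connectedComponentIn (D ∩ E) x) :=
  isContinuum_connectedComponentIn (hD.isContinuum.1.inter_right hE.isContinuum.isClosed)
    ⟨hD.left_mem, hE.left_mem⟩

theorem right_notMem_connectedComponentIn_inter (hD : IsIrreducibleBetween D x y)
    (hE : IsIrreducibleBetween E x y) (hDE : D ≠ E) : y ∉ connectedComponentIn (D ∩ E) x := by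
  intro hy
  have hP := hD.isContinuum_connectedComponentIn_inter hE
  have hx := mem_connectedComponentIn (mem_inter hD.left_mem hE.left_mem)
  have hsub := connectedComponentIn_subset (D ∩ E) x
  exact hDE ((hD.eq_of_subset ⟨hP, hx, hy⟩ (hsub.trans inter_subset_left)).symm.trans
    (hE.eq_of_subset ⟨hP, hx, hy⟩ (hsub.trans inter_subset_right)))

theorem disjoint_connectedComponentIn_inter (hD : IsIrreducibleBetween D x y)
    (hE : IsIrreducibleBetween E x y) (hDE : D ≠ E) :
    Disjoint (connectedComponentIn (D ∩ E) x) (connectedComponentIn (D ∩ E) y) := by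
  rw [Set.disjoint_left]
  intro z hx hy
  apply hD.right_notMem_connectedComponentIn_inter hE hDE
  rw [connectedComponentIn_eq hx, ← connectedComponentIn_eq hy]
  exact mem_connectedComponentIn ⟨hD.right_mem, hE.right_mem⟩

end IsIrreducibleBetween

theorem irreducibleContinua_comm : irreducibleContinua G x y = irreducibleContinua G y x :=
  Set.ext fun _ => ⟨.imp_left .symm, .imp_left .symm⟩

theorem IsContinuum.exists_isIrreducibleBetween [T2Space X] (hK : IsContinuum K) (hx : x ∈ K)
    (hy : y ∈ K) : ∃ D ⊆ K, IsIrreducibleBetween D x y :=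
  zorn_superset_nonempty {N : Set X | IsContinuum N ∧ x ∈ N ∧ y ∈ N}
    (fun c hcS hc hne => ⟨⋂₀ c, ⟨isContinuum_sInter (fun _ hN => (hcS hN).1)
      (fun s hs t ht => (hc.total hs ht).elim (fun h => ⟨s, hs, Subset.rfl, h⟩)
        fun h => ⟨t, ht, h, Subset.rfl⟩) hne, fun _ hN => (hcS hN).2.1, fun _ hN => (hcS hN).2.2⟩,
      fun _ => sInter_subset_of_mem⟩) K ⟨hK, hx, hy⟩

variable [T4Space X]

theorem Atriodic.inter_eq_union_connectedComponentIn (h : Atriodic G)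
    (hD : D ∈ irreducibleContinua G x y) (hE : E ∈ irreducibleContinua G x y) (hDE : D ≠ E) :
    D ∩ E = connectedComponentIn (D ∩ E) x ∪ connectedComponentIn (D ∩ E) y :=
  eq_union_connectedComponentIn_of_card_le_two
    ((h.mono (union_subset hD.2 hE.2)).card_connectedComponents_inter_le_two hD.1.isContinuum
      hE.1.isContinuum)
    ⟨hD.1.left_mem, hE.1.left_mem⟩ ⟨hD.1.right_mem, hE.1.right_mem⟩
    (hD.1.right_notMem_connectedComponentIn_inter hE.1 hDE)

/-- If `p` lay in all three components `P ∋ x`, `Q ∋ y` and `A ∋ x`, then irreducibility would give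
`D = P ∪ Q` and `F = A ∪ Q`, and of the continua `A`, `P`, `Q` through `p` one would be
redundant. -/
theorem Atriodic.notMem_connectedComponentIn_inter (h : Atriodic G)
    (hD : D ∈ irreducibleContinua G x y) (hE : E ∈ irreducibleContinua G x y)
    (hF : F ∈ irreducibleContinua G x y) (hDE : D ≠ E) (hDF : D ≠ F) (hEF : E ≠ F)
    (hpP : p ∈ connectedComponentIn (D ∩ E) x) (hpQ : p ∈ connectedComponentIn (D ∩ F) y) :
    p ∉ connectedComponentIn (E ∩ F) x := by
  intro hpA
  have hP := hD.1.isContinuum_connectedComponentIn_inter hE.1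
  have hQ := hD.1.symm.isContinuum_connectedComponentIn_inter hF.1.symm
  have hA := hE.1.isContinuum_connectedComponentIn_inter hF.1
  have hxP := mem_connectedComponentIn (mem_inter hD.1.left_mem hE.1.left_mem)
  have hyQ := mem_connectedComponentIn (mem_inter hD.1.right_mem hF.1.right_mem)
  have hxA := mem_connectedComponentIn (mem_inter hE.1.left_mem hF.1.left_mem)
  have hyP := hD.1.right_notMem_connectedComponentIn_inter hE.1 hDE
  have hyA := hE.1.right_notMem_connectedComponentIn_inter hF.1 hEF
  have hPsub := connectedComponentIn_subset (D ∩ E) x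
  have hQsub := connectedComponentIn_subset (D ∩ F) y
  have hAsub := connectedComponentIn_subset (E ∩ F) x
  set P := connectedComponentIn (D ∩ E) x
  set Q := connectedComponentIn (D ∩ F) y
  set A := connectedComponentIn (E ∩ F) x
  have hD_eq : P ∪ Q = D := hD.1.union_eq hP hQ (hPsub.trans inter_subset_left)
    (hQsub.trans inter_subset_left) hxP hyQ ⟨p, hpP, hpQ⟩
  have hF_eq : A ∪ Q = F := hF.1.union_eq hA hQ (hAsub.trans inter_subset_right)
    (hQsub.trans inter_subset_right) hxA hyQ ⟨p, hpA, hpQ⟩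
  have hAPQ : Atriodic (A ∪ P ∪ Q) := h.mono <| by
    rw [union_assoc, hD_eq]
    exact union_subset ((hAsub.trans inter_subset_left).trans hE.2) hD.2
  rcases hAPQ.subset_union_or_subset_union hA hP hQ hpA hpP hpQ with hsub | hsub | hsub
  · have hFD : F ⊆ D := hF_eq.ge.trans ((union_subset hsub subset_union_right).trans hD_eq.le)
    exact hDF (hD.1.eq_of_subset hF.1.prop hFD).symm
  · have hDF_sub : D ⊆ F := hD_eq.ge.trans ((union_subset hsub subset_union_right).trans hF_eq.le)
    exact hDF (hF.1.eq_of_subset hD.1.prop hDF_sub)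
  · exact (hsub hyQ).elim hyA hyP

theorem Atriodic.disjoint_connectedComponentIn_inter (h : Atriodic G)
    (hD : D ∈ irreducibleContinua G x y) (hE : E ∈ irreducibleContinua G x y)
    (hF : F ∈ irreducibleContinua G x y) (hDE : D ≠ E) (hDF : D ≠ F) (hEF : E ≠ F) :
    Disjoint (connectedComponentIn (D ∩ E) x) (connectedComponentIn (D ∩ F) y) := by
  rw [Set.disjoint_left]
  intro p hpP hpQ
  have hp : p ∈ E ∩ F :=
    ⟨(connectedComponentIn_subset _ _ hpP).2, (connectedComponentIn_subset _ _ hpQ).2⟩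
  rw [h.inter_eq_union_connectedComponentIn hE hF hEF] at hp
  rcases hp with hp | hp
  · exact h.notMem_connectedComponentIn_inter hD hE hF hDE hDF hEF hpP hpQ hp
  · rw [irreducibleContinua_comm] at hD hE hF
    rw [inter_comm] at hp
    exact h.notMem_connectedComponentIn_inter hD hF hE hDF hDE hEF.symm hpQ hpP hp

theorem Atriodic.not_subset_union (h : Atriodic G) (hD : D ∈ irreducibleContinua G x y)
    (hE : E ∈ irreducibleContinua G x y) (hF : F ∈ irreducibleContinua G x y) (hDE : D ≠ E)
    (hDF : D ≠ F) (hEF : E ≠ F) : ¬ D ⊆ E ∪ F := by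
  intro hsub
  have hE_eq := h.inter_eq_union_connectedComponentIn hD hE hDE
  have hF_eq := h.inter_eq_union_connectedComponentIn hD hF hDF
  have hcover : D ⊆ (connectedComponentIn (D ∩ E) x ∪ connectedComponentIn (D ∩ F) x) ∪
      (connectedComponentIn (D ∩ E) y ∪ connectedComponentIn (D ∩ F) y) := by
    rw [union_union_union_comm, ← hE_eq, ← hF_eq, ← inter_union_distrib_left]
    exact subset_inter Subset.rfl hsub
  have hclosed : ∀ {N} {a b : X}, IsIrreducibleBetween D a b → IsIrreducibleBetween N a b →
      IsClosed (connectedComponentIn (D ∩ N) a) :=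
    fun hD hN => (hD.isContinuum_connectedComponentIn_inter hN).isClosed
  obtain ⟨z, -, hzx, hzy⟩ := isPreconnected_closed_iff.1 hD.1.isContinuum.2.2 _ _
    ((hclosed hD.1 hE.1).union (hclosed hD.1 hF.1))
    ((hclosed hD.1.symm hE.1.symm).union (hclosed hD.1.symm hF.1.symm)) hcover
    ⟨x, hD.1.left_mem, .inl (mem_connectedComponentIn ⟨hD.1.left_mem, hE.1.left_mem⟩)⟩
    ⟨y, hD.1.right_mem, .inl (mem_connectedComponentIn ⟨hD.1.right_mem, hE.1.right_mem⟩)⟩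
  rcases hzx with hzx | hzx <;> rcases hzy with hzy | hzy
  · exact (hD.1.disjoint_connectedComponentIn_inter hE.1 hDE).le_bot ⟨hzx, hzy⟩
  · exact (h.disjoint_connectedComponentIn_inter hD hE hF hDE hDF hEF).le_bot ⟨hzx, hzy⟩
  · exact (h.disjoint_connectedComponentIn_inter hD hF hE hDF hDE hEF.symm).le_bot ⟨hzx, hzy⟩
  · exact (hD.1.disjoint_connectedComponentIn_inter hF.1 hDF).le_bot ⟨hzx, hzy⟩

theorem Atriodic.encard_irreducibleContinua_le_two (h : Atriodic G) :
    (irreducibleContinua G x y).encard ≤ 2 := by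
  by_contra! hcard
  obtain ⟨t, ht, ht3⟩ := exists_subset_encard_eq (Order.add_one_le_of_lt hcard)
  obtain ⟨D, E, F, hDE, hDF, hEF, rfl⟩ := encard_eq_three.1 ht3
  obtain ⟨hD, hE, hF⟩ : D ∈ irreducibleContinua G x y ∧ E ∈ irreducibleContinua G x y ∧
      F ∈ irreducibleContinua G x y := by
    simpa only [insert_subset_iff, singleton_subset_iff] using ht
  rcases (h.mono (union_subset (union_subset hD.2 hE.2) hF.2)).subset_union_or_subset_union
    hD.1.isContinuum hE.1.isContinuum hF.1.isContinuum hD.1.left_mem hE.1.left_mem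
    hF.1.left_mem with hsub | hsub | hsub
  · exact h.not_subset_union hD hE hF hDE hDF hEF hsub
  · exact h.not_subset_union hE hD hF hDE.symm hEF hDF hsub
  · exact h.not_subset_union hF hD hE hDF.symm hEF.symm hDE hsub

end Irreducible

section ShortestWalks

open SimpleGraph

variable {V : Type*} {G : SimpleGraph V} {u v : V}

theorem sub_le_dist_getVert (hG : G.Connected) (w : G.Walk u v) (hw : w.length = G.dist u v)
    {i j : ℕ} (hj : j ≤ w.length) : j - i ≤ G.dist (w.getVert i) (w.getVert j) := by
  have htake := (dist_le (w.take i)).trans_eq (w.take_length i)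
  have hdrop := (dist_le (w.drop j)).trans_eq (w.drop_length j)
  have htriangle := hG.dist_triangle (u := u) (v := w.getVert i) (w := v)
  have htriangle' := hG.dist_triangle (u := w.getVert i) (v := w.getVert j) (w := v)
  omega

end ShortestWalks

section Chains

variable {X : Type*} [TopologicalSpace X] {𝓕 : Set (Set X)} {I : Set X} {K : ℕ → Set X}
  {x y z z' : X} {i j k : ℕ}

theorem isContinuum_biUnion_of_ordConnected {t : Set ℕ} (ht : t.OrdConnected) (hfin : t.Finite)
    (hne : t.Nonempty) (hK : ∀ i ∈ t, IsContinuum (K i))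
    (hmeet : ∀ i ∈ t, i + 1 ∈ t → (K i ∩ K (i + 1)).Nonempty) : IsContinuum (⋃ i ∈ t, K i) :=
  ⟨hfin.isCompact_biUnion fun i hi => (hK i hi).1,
    IsConnected.biUnion_of_chain hne ht (fun i hi => (hK i hi).2) hmeet⟩

/-- The nerve of a family of sets: its members are the vertices, and an edge joins two of them
whenever they meet. -/
def nerve {X : Type*} (𝓕 : Set (Set X)) : SimpleGraph 𝓕 where
  Adj F F' := F ≠ F' ∧ ((F : Set X) ∩ F').Nonempty
  symm := ⟨fun F F' h => ⟨h.1.symm, inter_comm (F : Set X) F' ▸ h.2⟩⟩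
  loopless := ⟨fun _ h => h.1 rfl⟩

theorem nerve_preconnected (hfin : 𝓕.Finite) (hclosed : ∀ F ∈ 𝓕, IsClosed F)
    (hne : ∀ F ∈ 𝓕, F.Nonempty) (hpre : IsPreconnected (⋃₀ 𝓕)) : (nerve 𝓕).Preconnected := by
  intro F F'
  by_contra hFF'
  have : Finite 𝓕 := hfin
  have hunion : ∀ s : Set 𝓕, IsClosed (⋃ H ∈ s, (H : Set X)) := fun s =>
    s.toFinite.isClosed_biUnion fun H _ => hclosed H H.2
  let R : Set 𝓕 := {H | (nerve 𝓕).Reachable F H}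
  have hmem : ∀ (s : Set 𝓕) (H : 𝓕), H ∈ s → (⋃₀ 𝓕 ∩ ⋃ H ∈ s, (H : Set X)).Nonempty :=
    fun s H hs => (hne H H.2).imp fun z hz => ⟨⟨H, H.2, hz⟩, mem_biUnion hs hz⟩
  obtain ⟨z, -, hz, hz'⟩ := isPreconnected_closed_iff.1 hpre _ _ (hunion R) (hunion Rᶜ)
    (fun z ⟨H, hH, hz⟩ => (em (⟨H, hH⟩ ∈ R)).imp (fun h => mem_biUnion h hz)
      fun h => mem_biUnion (t := fun H : 𝓕 => (H : Set X)) h hz)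
    (hmem R F .rfl) (hmem Rᶜ F' hFF')
  obtain ⟨H, hH, hzH⟩ := mem_iUnion₂.1 hz
  obtain ⟨H', hH', hzH'⟩ := mem_iUnion₂.1 hz'
  have hHH' : H ≠ H' := fun heq => hH' (heq ▸ hH)
  exact hH' (hH.trans (SimpleGraph.Adj.reachable ⟨hHH', z, hzH, hzH'⟩))

/-- `K 0, …, K k` is a chain of continua from `x` to `y` with union `I` in which only consecutive
links meet. -/
structure IsTautChain (I : Set X) (x y : X) (K : ℕ → Set X) (k : ℕ) : Prop where
  isContinuum : ∀ i ≤ k, IsContinuum (K i)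
  left_mem : x ∈ K 0
  right_mem : y ∈ K k
  meets : ∀ i < k, (K i ∩ K (i + 1)).Nonempty
  disjoint : ∀ i j, i + 2 ≤ j → j ≤ k → Disjoint (K i) (K j)
  biUnion_eq : ⋃ i ∈ Iic k, K i = I

/-- A shortest path in the nerve of `𝓕` is a taut chain. -/
theorem IsIrreducibleBetween.exists_isTautChain [T2Space X] (hI : IsIrreducibleBetween I x y)
    (hfin : 𝓕.Finite) (hcont : ∀ F ∈ 𝓕, IsContinuum F) (hunion : ⋃₀ 𝓕 = I) :
    ∃ K k, IsTautChain I x y K k ∧ ∀ i ≤ k, K i ∈ 𝓕 := by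
  obtain ⟨F, hF, hxF⟩ := hunion.ge hI.left_mem
  obtain ⟨F', hF', hyF'⟩ := hunion.ge hI.right_mem
  have hconn : (nerve 𝓕).Connected :=
    { preconnected := nerve_preconnected hfin (fun F hF => (hcont F hF).isClosed)
        (fun F hF => (hcont F hF).2.1) (hunion ▸ hI.isContinuum.2.2)
      nonempty := ⟨⟨F, hF⟩⟩ }
  obtain ⟨w, hw⟩ := hconn.exists_walk_length_eq_dist ⟨F, hF⟩ ⟨F', hF'⟩
  let K : ℕ → Set X := fun i => w.getVert i
  have hK : ∀ i, IsContinuum (K i) := fun i => hcont _ (w.getVert i).2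
  have hx : x ∈ K 0 := by simpa [K] using hxF
  have hy : y ∈ K w.length := by simpa [K] using hyF'
  have hmeet : ∀ i < w.length, (K i ∩ K (i + 1)).Nonempty := fun i hi =>
    (w.adj_getVert_succ hi).2
  refine ⟨K, w.length, ⟨fun i _ => hK i, hx, hy, hmeet, fun i j hij hj => ?_, ?_⟩,
    fun i _ => (w.getVert i).2⟩
  · have hdist := sub_le_dist_getVert hconn w hw (i := i) hj
    by_contra hinter
    have hadj : (nerve 𝓕).Adj (w.getVert i) (w.getVert j) := by
      refine ⟨fun heq => ?_, not_disjoint_iff_nonempty_inter.1 hinter⟩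
      rw [heq, SimpleGraph.dist_self] at hdist
      omega
    rw [SimpleGraph.dist_eq_one_iff_adj.2 hadj] at hdist
    omega
  · exact hI.eq_of_subset ⟨isContinuum_biUnion_of_ordConnected ordConnected_Iic (finite_Iic _)
      nonempty_Iic (fun i _ => hK i) (fun i _ hi => hmeet i hi),
      mem_biUnion (mem_Iic.2 (Nat.zero_le _)) hx, mem_biUnion (mem_Iic.2 le_rfl) hy⟩
      (iUnion₂_subset fun i _ => hunion ▸ subset_sUnion_of_mem (w.getVert i).2)

/-- The part of `I` between `x` and `z`: the intersection of all subcontinua of `I` that contain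
both. It need not be connected. -/
def initialPart (I : Set X) (x z : X) : Set X :=
  ⋂₀ {N | IsContinuum N ∧ N ⊆ I ∧ x ∈ N ∧ z ∈ N}

theorem left_mem_initialPart : x ∈ initialPart I x z := fun _ hN => hN.2.2.1

theorem right_mem_initialPart : z ∈ initialPart I x z := fun _ hN => hN.2.2.2

theorem IsContinuum.initialPart_subset (hI : IsContinuum I) (hx : x ∈ I) (hz : z ∈ I) :
    initialPart I x z ⊆ I :=
  sInter_subset_of_mem ⟨hI, Subset.rfl, hx, hz⟩

theorem IsContinuum.isCompact_initialPart [T2Space X] (hI : IsContinuum I) (hx : x ∈ I)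
    (hz : z ∈ I) : IsCompact (initialPart I x z) :=
  hI.1.of_isClosed_subset (isClosed_sInter fun _ hN => hN.1.isClosed)
    (hI.initialPart_subset hx hz)

namespace IsTautChain

theorem subset (h : IsTautChain I x y K k) (hi : i ≤ k) : K i ⊆ I :=
  h.biUnion_eq ▸ subset_biUnion_of_mem (u := K) hi

theorem exists_mem (h : IsTautChain I x y K k) (hz : z ∈ I) : ∃ i ≤ k, z ∈ K i := by
  simpa using h.biUnion_eq.ge hz

theorem isContinuum_biUnion (h : IsTautChain I x y K k) {t : Set ℕ} (ht : t.OrdConnected)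
    (hne : t.Nonempty) (htk : t ⊆ Iic k) : IsContinuum (⋃ i ∈ t, K i) :=
  isContinuum_biUnion_of_ordConnected ht ((finite_Iic k).subset htk) hne
    (fun i hi => h.isContinuum i (htk hi)) fun i _ hi => h.meets i (htk hi)

theorem initialPart_subset (h : IsTautChain I x y K k) (hi : i ≤ k) (hz : z ∈ K i) :
    initialPart I x z ⊆ ⋃ m ∈ Iic i, K m :=
  sInter_subset_of_mem ⟨h.isContinuum_biUnion ordConnected_Iic nonempty_Iic (Iic_subset_Iic.2 hi),
    iUnion₂_subset fun _ hm => h.subset (hm.trans hi),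
    mem_biUnion (mem_Iic.2 (Nat.zero_le i)) h.left_mem,
    mem_biUnion (mem_Iic.2 le_rfl) hz⟩

/-- A continuum joining `x` to `z ∈ K i`, together with the links from `K i` on, is all of `I`. -/
theorem subset_initialPart (h : IsTautChain I x y K k) (hI : IsIrreducibleBetween I x y)
    (hi : i ≤ k) (hz : z ∈ K i) (hji : j + 2 ≤ i) : K j ⊆ initialPart I x z := by
  rintro q hq N ⟨hN, hNI, hxN, hzN⟩
  have htail := h.isContinuum_biUnion ordConnected_Icc (nonempty_Icc.2 hi) Icc_subset_Iic_self
  have heq := hI.union_eq hN htail hNI (iUnion₂_subset fun m hm => h.subset hm.2) hxN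
    (mem_biUnion (right_mem_Icc.2 hi) h.right_mem) ⟨z, hzN, mem_biUnion (left_mem_Icc.2 hi) hz⟩
  refine (heq.ge (h.subset (by omega) hq)).resolve_right fun hqm => ?_
  obtain ⟨m, hm, hqm⟩ := mem_iUnion₂.1 hqm
  exact (h.disjoint j m (hji.trans hm.1) hm.2).le_bot ⟨hq, hqm⟩

theorem initialPart_ssubset (h : IsTautChain I x y K k) (hI : IsIrreducibleBetween I x y)
    (hz : z ∈ K i) (hz' : z' ∈ K j) (hij : i + 2 ≤ j) (hj : j ≤ k) :
    initialPart I x z ⊂ initialPart I x z' := by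
  have hsub := h.initialPart_subset (i := i) (by omega) hz
  refine ssubset_iff_subset_ne.2 ⟨hsub.trans (iUnion₂_subset fun m (hm : m ≤ i) =>
    h.subset_initialPart hI hj hz' (by omega)), fun heq => ?_⟩
  obtain ⟨m, hm, hz'm⟩ := mem_iUnion₂.1 (hsub (heq.ge right_mem_initialPart))
  exact (h.disjoint m j (by have := mem_Iic.1 hm; omega) hj).le_bot ⟨hz'm, hz'⟩

end IsTautChain

end Chains

section PropertyS

variable {X : Type*} [MetricSpace X] {I : Set X} {K : ℕ → Set X} {x y z z' a b : X} {i j k : ℕ}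
  {ε : ℝ}

/-- `D` is a finite union of continua of diameter less than `ε`. -/
def IsFineUnion (D : Set X) (ε : ℝ) : Prop :=
  ∃ 𝓕 : Set (Set X), 𝓕.Finite ∧ (∀ F ∈ 𝓕, IsContinuum F ∧ diam F < ε) ∧ ⋃₀ 𝓕 = D

/-- Sierpiński's property S. -/
def HasPropertyS (D : Set X) : Prop :=
  ∀ ε > 0, IsFineUnion D ε

theorem IsFineUnion.mono {D : Set X} {δ : ℝ} (h : IsFineUnion D δ) (hδε : δ ≤ ε) :
    IsFineUnion D ε :=
  h.imp fun _ => .imp_right <| .imp_left fun h𝓕 F hF => (h𝓕 F hF).imp_right hδε.trans_lt'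

theorem IsIrreducibleBetween.exists_isTautChain_diam_lt (hI : IsIrreducibleBetween I x y)
    (hS : IsFineUnion I ε) : ∃ K k, IsTautChain I x y K k ∧ ∀ i ≤ k, diam (K i) < ε := by
  obtain ⟨𝓕, hfin, h𝓕, hunion⟩ := hS
  obtain ⟨K, k, hK, hmem⟩ := hI.exists_isTautChain hfin (fun F hF => (h𝓕 F hF).1) hunion
  exact ⟨K, k, hK, fun i hi => (h𝓕 _ (hmem i hi)).2⟩

namespace IsTautChain

theorem dist_lt (h : IsTautChain I x y K k) (hdiam : ∀ i ≤ k, diam (K i) < ε) (hij : i ≤ j)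
    (hji : j ≤ i + 1) (hj : j ≤ k) (ha : a ∈ K i) (hb : b ∈ K j) : dist a b < 2 * ε := by
  have hlink : ∀ i ≤ k, ∀ a ∈ K i, ∀ b ∈ K i, dist a b < ε := fun i hi a ha b hb =>
    (dist_le_diam_of_mem (h.isContinuum i hi).1.isBounded ha hb).trans_lt (hdiam i hi)
  rcases hij.eq_or_lt with rfl | hlt
  · linarith [hlink i hj a ha b hb, dist_nonneg (x := a) (y := b)]
  · obtain rfl : j = i + 1 := by omega
    obtain ⟨c, hci, hcj⟩ := h.meets i hj
    linarith [dist_triangle a c b, hlink i (by omega) a ha c hci, hlink _ hj c hcj b hb]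

theorem exists_mem_initialPart_dist_le (h : IsTautChain I x y K k)
    (hI : IsIrreducibleBetween I x y) (hdiam : ∀ i ≤ k, diam (K i) < ε) (hi : i ≤ k)
    (hz : z ∈ K i) (hz' : z' ∈ K i) (ha : a ∈ initialPart I x z) :
    ∃ b ∈ initialPart I x z', dist a b ≤ 2 * ε := by
  obtain ⟨m, hm : m ≤ i, ham⟩ := mem_iUnion₂.1 (h.initialPart_subset hi hz ha)
  by_cases hmi : m + 2 ≤ i
  · have hε : 0 < ε := diam_nonneg.trans_lt (hdiam i hi)
    exact ⟨a, h.subset_initialPart hI hi hz' hmi ham, by simpa using hε.le⟩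
  · exact ⟨z', right_mem_initialPart, (h.dist_lt hdiam hm (by omega) hi ham hz').le⟩

theorem hausdorffDist_initialPart_le (h : IsTautChain I x y K k)
    (hI : IsIrreducibleBetween I x y) (hdiam : ∀ i ≤ k, diam (K i) < ε) (hi : i ≤ k)
    (hz : z ∈ K i) (hz' : z' ∈ K i) :
    hausdorffDist (initialPart I x z) (initialPart I x z') ≤ 2 * ε :=
  hausdorffDist_le_of_mem_dist
    (by linarith [diam_nonneg.trans_lt (hdiam i hi)])
    (fun _ => h.exists_mem_initialPart_dist_le hI hdiam hi hz hz')
    fun _ => h.exists_mem_initialPart_dist_le hI hdiam hi hz' hz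

end IsTautChain

theorem IsIrreducibleBetween.initialPart_ssubset_or_ssubset (hI : IsIrreducibleBetween I x y)
    (hS : HasPropertyS I) (hz : z ∈ I) (hz' : z' ∈ I) (hne : z ≠ z') :
    initialPart I x z ⊂ initialPart I x z' ∨ initialPart I x z' ⊂ initialPart I x z := by
  obtain ⟨K, k, h, hdiam⟩ := hI.exists_isTautChain_diam_lt (hS _ (half_pos (dist_pos.2 hne)))
  obtain ⟨i, hi, hzi⟩ := h.exists_mem hz
  obtain ⟨j, hj, hzj⟩ := h.exists_mem hz'
  by_cases hij : i + 2 ≤ j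
  · exact .inl (h.initialPart_ssubset hI hzi hzj hij hj)
  by_cases hji : j + 2 ≤ i
  · exact .inr (h.initialPart_ssubset hI hzj hzi hji hi)
  rcases le_total i j with hle | hle
  · linarith [h.dist_lt hdiam hle (by omega) hj hzi hzj]
  · linarith [h.dist_lt hdiam hle (by omega) hi hzj hzi, dist_comm z z']

/-- `initialPart I x` as a map from `I` to the hyperspace of `X`, which carries the Hausdorff
metric. -/
def initialPartMap (hI : IsContinuum I) (hx : x ∈ I) (z : I) : NonemptyCompacts X where
  carrier := initialPart I x z
  isCompact' := hI.isCompact_initialPart hx z.2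
  nonempty' := ⟨x, left_mem_initialPart⟩

theorem IsIrreducibleBetween.continuous_initialPartMap (hI : IsIrreducibleBetween I x y)
    (hS : HasPropertyS I) : Continuous (initialPartMap hI.isContinuum hI.left_mem) := by
  refine continuous_iff'.2 fun z ε hε => ?_
  obtain ⟨K, k, h, hdiam⟩ := hI.exists_isTautChain_diam_lt (hS (ε / 3) (by positivity))
  have hnhds : ∀ᶠ z' : I in 𝓝 z, ∀ i ≤ k, (z' : X) ∈ K i → (z : X) ∈ K i := by
    refine (finite_Iic k).eventually_all.2 fun i hi => ?_
    by_cases hzi : (z : X) ∈ K i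
    · exact .of_forall fun _ _ => hzi
    · have hopen := (h.isContinuum i hi).isClosed.isOpen_compl.preimage
        (continuous_subtype_val (p := (· ∈ I)))
      filter_upwards [hopen.mem_nhds hzi] with z' hz' using fun hz'i => absurd hz'i hz'
  filter_upwards [hnhds] with z' hz'
  obtain ⟨i, hi, hz'i⟩ := h.exists_mem z'.2
  refine (h.hausdorffDist_initialPart_le hI hdiam hi hz'i (hz' i hi hz'i)).trans_lt ?_
  linarith

end PropertyS

section Whitney

variable {X : Type*} [MetricSpace X]

/-- The restriction of `w` to the nonempty compact subsets of `s` is, up to sign and additive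
normalization, a Whitney map: the weighted distances to a countable dense set. -/
theorem exists_continuous_strictAntiOn_nonemptyCompacts {s : Set X} (hs : IsSeparable s) :
    ∃ w : NonemptyCompacts X → ℝ,
      Continuous w ∧ StrictAntiOn w {A | (A : Set X) ⊆ s} := by
  obtain ⟨c, hc, hsc⟩ := hs
  have := hc.toEncodable
  obtain ⟨δ, hδ, C, hsum, -⟩ := posSumOfEncodable one_pos c
  let d : c → NonemptyCompacts X → ℝ := fun q A => δ q * min 1 (infDist (q : X) A)
  have hd_nonneg : ∀ q A, 0 ≤ d q A := fun q A =>
    mul_nonneg (hδ q).le (le_min zero_le_one infDist_nonneg)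
  have hd_le : ∀ q A, d q A ≤ δ q := fun q A =>
    mul_le_of_le_one_right (hδ q).le (min_le_left _ _)
  have hd_sum : ∀ A, Summable fun q => d q A := fun A =>
    hsum.summable.of_nonneg_of_le (hd_nonneg · A) (hd_le · A)
  refine ⟨fun A => ∑' q, d q A, continuous_tsum (fun q => ?_) hsum.summable fun q A => ?_,
    fun A _ B hB hAB => ?_⟩
  · exact continuous_const.mul (continuous_const.min (lipschitz_infDist_set (q : X)).continuous)
  · exact (Real.norm_of_nonneg (hd_nonneg q A)).trans_le (hd_le q A)
  · obtain ⟨b, hbB, hbA⟩ := exists_of_ssubset (SetLike.coe_ssubset_coe.2 hAB)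
    set r := infDist b A
    have hr : 0 < r := (A.isCompact.isClosed.notMem_iff_infDist_pos A.nonempty).1 hbA
    obtain ⟨q, hqc, hq⟩ := mem_closure_iff.1 (hsc (hB hbB)) (min 1 (r / 2)) (by positivity)
    have hqB : infDist q B ≤ dist b q := dist_comm b q ▸ infDist_le_dist_of_mem hbB
    have hbqA : r ≤ infDist q A + dist b q := infDist_le_infDist_add_dist
    refine (hd_sum B).tsum_lt_tsum (i := ⟨q, hqc⟩) (fun p => ?_) ?_ (hd_sum A)
    · exact mul_le_mul_of_nonneg_left
        (min_le_min_left 1 (infDist_le_infDist_of_subset hAB.le A.nonempty)) (hδ p).le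
    · refine mul_lt_mul_of_pos_left ?_ (hδ _)
      have hq1 := hq.trans_le (min_le_left _ _)
      have hqr := hq.trans_le (min_le_right _ _)
      exact (min_le_right _ _).trans_lt (lt_min (hqB.trans_lt hq1) (by linarith))

end Whitney

section Arcs

theorem IsContinuum.isArc {X : Type*} [TopologicalSpace X] {D : Set X} (hD : IsContinuum D)
    (hD' : D.Nontrivial) {f : D → ℝ} (hf : Continuous f) (hinj : Injective f) : IsArc D := by
  have : CompactSpace D := isCompact_iff_compactSpace.1 hD.1
  have : ConnectedSpace D := isConnected_iff_connectedSpace.1 hD.2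
  have : Nontrivial D := hD'.coe_sort
  have hrange := eq_Icc_of_connected_compact (isConnected_range hf) (isCompact_range hf)
  have hlt : sInf (range f) < sSup (range f) := by
    obtain ⟨u, v, huv⟩ := exists_pair_ne D
    by_contra! hle
    exact huv (hinj (subsingleton_Icc_of_ge hle (hrange ▸ mem_range_self u)
      (hrange ▸ mem_range_self v)))
  exact ⟨(((hf.isClosedEmbedding hinj).isEmbedding.toHomeomorph.trans
    (.setCongr hrange)).trans (iccHomeoI _ _ hlt)).symm⟩

theorem IsIrreducibleBetween.isArc {X : Type*} [MetricSpace X] {I : Set X} {x y : X}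
    (hI : IsIrreducibleBetween I x y) (hxy : x ≠ y) (hS : HasPropertyS I) : IsArc I := by
  obtain ⟨w, hw, hanti⟩ :=
    exists_continuous_strictAntiOn_nonemptyCompacts hI.isContinuum.1.isSeparable
  let Φ := initialPartMap hI.isContinuum hI.left_mem
  have hΦ : ∀ z, (Φ z : Set X) ⊆ I := fun z =>
    hI.isContinuum.initialPart_subset hI.left_mem z.2
  refine hI.isContinuum.isArc ⟨x, hI.left_mem, y, hI.right_mem, hxy⟩
    (hw.comp (hI.continuous_initialPartMap hS)) fun z z' heq => ?_
  by_contra hne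
  rcases hI.initialPart_ssubset_or_ssubset hS z.2 z'.2 (Subtype.coe_injective.ne hne) with h | h
  · exact (hanti (hΦ z) (hΦ z') h).ne' heq
  · exact (hanti (hΦ z') (hΦ z) h).ne heq

end Arcs

section Refinement

variable {X : Type*} [MetricSpace X] {C D : Set X} {ε : ℝ}

theorem Atriodic.isFineUnion_of_subset (h : Atriodic C) (hC : IsFineUnion C ε)
    (hD : IsContinuum D) (hDC : D ⊆ C) : IsFineUnion D ε := by
  obtain ⟨𝓚, hfin, h𝓚, rfl⟩ := hC
  refine ⟨⋃ K ∈ 𝓚, connectedComponentIn (D ∩ K) '' (D ∩ K), hfin.biUnion fun K hK => ?_,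
    fun F hF => ?_, Subset.antisymm (sUnion_subset fun F hF => ?_) fun z hz => ?_⟩
  · have := (h.mono (union_subset hDC (subset_sUnion_of_mem hK)))
      |>.finite_connectedComponents_inter hD (h𝓚 K hK).1
    exact finite_image_connectedComponentIn
  · obtain ⟨K, hK, z, hz, rfl⟩ := mem_iUnion₂.1 hF
    have hKc := (h𝓚 K hK).1
    exact ⟨isContinuum_connectedComponentIn (hD.1.inter hKc.1) hz,
      (diam_mono ((connectedComponentIn_subset _ _).trans inter_subset_right)
        hKc.1.isBounded).trans_lt (h𝓚 K hK).2⟩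
  · obtain ⟨K, -, z, -, rfl⟩ := mem_iUnion₂.1 hF
    exact (connectedComponentIn_subset _ _).trans inter_subset_left
  · obtain ⟨K, hK, hzK⟩ := hDC hz
    exact ⟨_, mem_biUnion hK (mem_image_of_mem _ ⟨hz, hzK⟩), mem_connectedComponentIn ⟨hz, hzK⟩⟩

theorem exists_hasPropertyS_of_finite {𝓓 : Set (Set X)} (hfin : 𝓓.Finite)
    (h : ∀ δ ∈ Ioc 0 ε, ∃ D ∈ 𝓓, IsFineUnion D δ) (hε : 0 < ε) : ∃ D ∈ 𝓓, HasPropertyS D := by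
  by_contra! hcon
  have hsmall : ∀ᶠ δ in 𝓝[>] (0 : ℝ), ∀ D ∈ 𝓓, ¬ IsFineUnion D δ := by
    refine hfin.eventually_all.2 fun D hD => ?_
    obtain ⟨η, hη, hDη⟩ := by simpa only [HasPropertyS, not_forall] using hcon D hD
    filter_upwards [Ioc_mem_nhdsGT hη] with δ hδ hDδ using hDη (hDδ.mono hδ.2)
  obtain ⟨δ, hδ, hδε⟩ := (hsmall.and (Ioc_mem_nhdsGT hε)).exists
  obtain ⟨D, hD, hDδ⟩ := h δ hδε
  exact hδ D hD hDδ

end Refinement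

theorem joined_of_mem_arcRel {X : Type*} [TopologicalSpace X] {x y : X}
    (h : (x, y) ∈ arcRel X) : Joined x y := by
  obtain (rfl : x = y) | ⟨A, ⟨e⟩, hx, hy⟩ := h
  · exact .refl x
  · have : PathConnectedSpace unitInterval := isPathConnected_iff_pathConnectedSpace.1 <|
      (convex_Icc (0 : ℝ) 1).isPathConnected (nonempty_Icc.2 zero_le_one)
    have : PathConnectedSpace A := e.surjective.pathConnectedSpace e.continuous
    exact (PathConnectedSpace.joined (⟨x, hx⟩ : A) ⟨y, hy⟩).map continuous_subtype_val

section Relations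

variable {X : Type*} [MetricSpace X] {x y : X} {δ ε : ℝ}

theorem chainRelAt_mono (h : δ ≤ ε) : chainRelAt X δ ⊆ chainRelAt X ε :=
  fun _ ⟨k, K, hK, hchain⟩ => ⟨k, K, fun i hi => (hK i hi).imp_right h.trans_lt', hchain⟩

theorem exists_isFineUnion_of_mem_chainRelAt (h : (x, y) ∈ chainRelAt X ε) :
    ∃ C ⊆ relClass (chainRelAt X ε) x, IsContinuum C ∧ IsFineUnion C ε ∧ x ∈ C ∧ y ∈ C := by
  obtain ⟨k, K, hK, hx, hy, hmeet⟩ := h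
  refine ⟨⋃ i ∈ Iic k, K i, iUnion₂_subset fun i (hi : i ≤ k) z hz => ?_,
    isContinuum_biUnion_of_ordConnected ordConnected_Iic (finite_Iic k) nonempty_Iic
      (fun i hi => (hK i hi).1) fun i _ hi => hmeet i hi,
    ⟨K '' Iic k, (finite_Iic k).image K, forall_mem_image.2 hK, sUnion_image K _⟩,
    mem_biUnion (mem_Iic.2 k.zero_le) hx, mem_biUnion self_mem_Iic hy⟩
  exact ⟨i, K, fun j hj => hK j (hj.trans hi), hx, hz, fun j hj => hmeet j (hj.trans_le hi)⟩

theorem exists_mem_irreducibleContinua_isFineUnion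
    (h : Atriodic (relClass (chainRelAt X ε) x)) (hδε : δ ≤ ε) (hxy : (x, y) ∈ chainRelAt X δ) :
    ∃ D ∈ irreducibleContinua (relClass (chainRelAt X ε) x) x y, IsFineUnion D δ := by
  obtain ⟨C, hCδ, hC, hfine, hxC, hyC⟩ := exists_isFineUnion_of_mem_chainRelAt hxy
  obtain ⟨D, hDC, hD⟩ := hC.exists_isIrreducibleBetween hxC hyC
  have hCε : C ⊆ relClass (chainRelAt X ε) x := fun z hz => chainRelAt_mono hδε (hCδ hz)
  exact ⟨D, ⟨hD, hDC.trans hCε⟩, (h.mono hCε).isFineUnion_of_subset hfine hD.isContinuum hDC⟩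

theorem mem_arcRel_of_mem_chainRel (hε : 0 < ε) (h : Atriodic (relClass (chainRelAt X ε) x))
    (hxy : (x, y) ∈ chainRel X) : (x, y) ∈ arcRel X := by
  refine or_iff_not_imp_left.2 fun hne => ?_
  obtain ⟨D, hD, hS⟩ := exists_hasPropertyS_of_finite
    (finite_of_encard_le_coe h.encard_irreducibleContinua_le_two)
    (fun δ hδ => exists_mem_irreducibleContinua_isFineUnion h hδ.2 (hxy δ hδ.1)) hε
  exact ⟨D, hD.1.isArc hne hS, hD.1.left_mem, hD.1.right_mem⟩

theorem mem_chainRel_of_path (γ : Path x y) : (x, y) ∈ chainRel X := by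
  intro ε hε
  obtain ⟨t, ht0, hmono, ⟨n, hn⟩, hball⟩ := exists_monotone_Icc_subset_open_cover_unitInterval
    (c := fun z => γ ⁻¹' ball z (ε / 3)) (fun z => isOpen_ball.preimage γ.continuous)
    fun s _ => mem_iUnion.2 ⟨γ s, mem_ball_self (by positivity)⟩
  have hstep : ∀ i, t i ≤ t (i + 1) := fun i => hmono i.le_succ
  refine ⟨n, fun i => γ '' Icc (t i) (t (i + 1)), fun i _ =>
    ⟨⟨isCompact_Icc.image γ.continuous,
      (isConnected_Icc (hstep i)).image γ γ.continuous.continuousOn⟩, ?_⟩,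
    ⟨0, ⟨ht0.le, bot_le⟩, γ.source⟩, ⟨1, ⟨le_top, (hn _ n.le_succ).ge⟩, γ.target⟩, fun i _ =>
    ⟨_, mem_image_of_mem γ (right_mem_Icc.2 (hstep i)),
      mem_image_of_mem γ (left_mem_Icc.2 (hstep (i + 1)))⟩⟩
  obtain ⟨z, hz⟩ := hball i
  calc diam (γ '' Icc (t i) (t (i + 1))) ≤ diam (ball z (ε / 3)) :=
        diam_mono (image_subset_iff.2 hz) isBounded_ball
    _ ≤ 2 * (ε / 3) := diam_ball (by positivity)
    _ < ε := by linarith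

end Relations

end ContinuumConnection

theorem mainTheorem11_general {X : Type*} [MetricSpace X]
    (h : ∀ x : X, ∃ ε > 0, Atriodic (relClass (chainRelAt X ε) x)) : chainRel X = arcRel X := by
  refine Set.Subset.antisymm (fun ⟨x, y⟩ hxy => ?_) fun ⟨x, y⟩ hxy => ?_
  · obtain ⟨ε, hε, hx⟩ := h x
    exact mem_arcRel_of_mem_chainRel hε hx hxy
  · exact mem_chainRel_of_path (joined_of_mem_arcRel hxy).somePath

theorem mainTheorem11 :
    (∀ (X : Type*) [MetricSpace X],
      (∀ n : ℕ, 1 ≤ n → ∀ x : X,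
        ¬ ∃ T : Set X, IsTriod T ∧ T ⊆ relClass (chainRelAt X (1 / (n : ℝ))) x) →
      chainRel X = arcRel X) ∧
    (∀ (X : Type*) [MetricSpace X] [PolishSpace X],
      (¬ ∃ T : Set X, IsTriod T) →
      chainRel X = arcRel X) :=
  ⟨fun _ _ h => mainTheorem11_general fun x => ⟨1 / (1 : ℕ), by simp, h 1 le_rfl x⟩,
    fun _ _ _ h => mainTheorem11_general fun _ => ⟨1, one_pos, fun ⟨T, hT, _⟩ => h ⟨T, hT⟩⟩⟩
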